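/- Let $\mathfrak c$ be the cardinality of $\mathbb R$; "measurable" means Lebesgue measurable. For $F\colon\mathbb R^2\to\mathbb R$ and $f\colon\mathbb R\to\mathbb R$ put $F_f(x)=F(x,f(x))$. The function $F$ is \emph{sup-measurable} if $F_f$ is measurable for every measurable $f\colon\mathbb R\to\mathbb R$, and \emph{weakly sup-measurable} if $F_f$ is measurable for every continuous, almost everywhere differentiable $f\colon\mathbb R\to\mathbb R$. A subset $A$ of a commutative algebra is \emph{strongly $\kappa$-algebrable} if $A\cup\{0\}$ contains a (not necessarily unital) subalgebra which is free as a commutative algebra on a set of $\kappa$ generators, that is, a subalgebra generated by a set $X$ of cardinality $\kappa$ such that $P(x_1,\dots,x_k)\neq 0$ for all $k\ge 1$, all distinct $x_1,\dots,x_k\in X$ and every non-zero polynomial $P$ in $k$ variables without constant term. Assume the following condition. (A) There is a function $f\colon\mathbb R\to\mathbb R$ whose graph is the union of a family $\{f_\alpha\colon\alpha<\mathfrak c\}$ of pairwise disjoint (graphs of) partial functions, each of positive Lebesgue outer measure in $\mathbb R^2$, such that $\{x\in\mathbb R\colon f(x)=g(x)\}$ is a null set for every continuous $g\colon\mathbb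 R\to\mathbb R$. Then the family of all weakly sup-measurable functions $F\colon\mathbb R^2\to\mathbb R$ that are neither sup-measurable nor measurable is strongly $2^{\mathfrak c}$-algebrable in the real algebra $\mathbb R^{\mathbb R^2}$ of all functions $\mathbb R^2\to\mathbb R$ with pointwise operations. -/

import Mathlib

open MeasureTheory
open scoped Cardinal

/-- The free commutative (not necessarily unital) `K`-algebra on a set `σ` of generators:
the polynomials over `K` in the variables `σ` without constant term. -/
def freeCommAlgebra (K σ : Type*) [Field K] : NonUnitalSubalgebra K (MvPolynomial σ K) where
  carrier := {P | MvPolynomial.constantCoeff P = 0}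
  add_mem' := by
    intro P Q hP hQ
    simp only [Set.mem_ofPred_eq] at hP hQ ⊢
    rw [map_add, hP, hQ, add_zero]
  zero_mem' := by simp
  mul_mem' := by
    intro P Q hP hQ
    simp only [Set.mem_ofPred_eq] at hP hQ ⊢
    rw [map_mul, hP, zero_mul]
  smul_mem' := by
    intro c P hP
    simp only [Set.mem_ofPred_eq] at hP ⊢
    rw [MvPolynomial.smul_eq_C_mul, map_mul, hP, mul_zero]

/-- The free generators of `freeCommAlgebra K σ`. -/
noncomputable def freeCommAlgebra.gen (K : Type*) {σ : Type*} [Field K] (i : σ) :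
    freeCommAlgebra K σ :=
  ⟨MvPolynomial.X i, MvPolynomial.constantCoeff_X K i⟩

/-- A subset `A` of a commutative `K`-algebra `L` is strongly `κ`-algebrable if `A ∪ {0}` contains
a (not necessarily unital) subalgebra which is generated by a set `X` of cardinality `κ` and is
isomorphic to a free algebra, with `X` as a set of free generators. -/
def StronglyAlgebrable (K : Type*) {L : Type*} [Field K] [CommRing L] [Algebra K L]
    (κ : Cardinal) (A : Set L) : Prop :=
  ∃ B : NonUnitalSubalgebra K L, (B : Set L) ⊆ A ∪ {0} ∧
    ∃ X : Set L, #X = κ ∧ NonUnitalAlgebra.adjoin K X = B ∧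
      ∃ e : freeCommAlgebra K X →ₙₐ[K] B, Function.Bijective e ∧
        ∀ x : X, (e (freeCommAlgebra.gen K x) : L) = x

/-- Lebesgue measurability of a real function (on `ℝ` or on `ℝ × ℝ`): preimages of Borel sets
belong to the completion of the Borel σ-algebra with respect to Lebesgue measure. -/
def LebesgueMeasurable {α : Type*} [MeasureSpace α] (f : α → ℝ) : Prop :=
  NullMeasurable f (volume : Measure α)

/-- The Carathéodory superposition `F_f (x) = F (x, f x)`. -/
def caratheodorySuperposition (F : ℝ × ℝ → ℝ) (f : ℝ → ℝ) : ℝ → ℝ :=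
  fun x => F (x, f x)

/-- `F` is sup-measurable. -/
def SupMeasurable (F : ℝ × ℝ → ℝ) : Prop :=
  ∀ f : ℝ → ℝ, LebesgueMeasurable f → LebesgueMeasurable (caratheodorySuperposition F f)

/-- `F` is weakly sup-measurable. -/
def WeaklySupMeasurable (F : ℝ × ℝ → ℝ) : Prop :=
  ∀ f : ℝ → ℝ, Continuous f → (∀ᵐ x : ℝ, DifferentiableAt ℝ f x) →
    LebesgueMeasurable (caratheodorySuperposition F f)

/-- Condition (A): some `f : ℝ → ℝ` agrees with each continuous function only on a null set, and
its graph is the union of `𝔠` many pairwise disjoint sets (graphs of partial functions), each of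
positive planar Lebesgue outer measure. (On an arbitrary set, `volume` is the outer measure.) -/
def ConditionA : Prop :=
  ∃ (f : ℝ → ℝ) (ι : Type) (G : ι → Set (ℝ × ℝ)),
    #ι = 𝔠 ∧
    Pairwise (fun α β => Disjoint (G α) (G β)) ∧
    (⋃ α, G α) = {p : ℝ × ℝ | p.2 = f p.1} ∧
    (∀ α, 0 < volume (G α)) ∧
    ∀ g : ℝ → ℝ, Continuous g → volume {x : ℝ | f x = g x} = 0

-- All functions constructed live on two graphs: that of a Borel function r (`roughFunction`) and
-- that of the f from (A). Each point of the plane gets a colour in `Option ι`: a Bernstein-type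
-- colour on the graph of r, the index of its piece elsewhere on the graph of f, and `none` off
-- both. With 2^𝔠 algebraically independent functions u_A on ι, the generators are u_A(colour), read
-- as 0 at `none`. A non-zero polynomial combination F without constant term is again a function of
-- the colour, zero at `none` and non-zero at some i.
--
-- A continuous a.e. differentiable g meets both graphs over null sets (`volume_roughFunction_eq`
-- and (A)), so F_g = 0 a.e. The support of F_r is a Bernstein-type set, so F is not sup-measurable.
-- If F were measurable, its support, with finite vertical sections, would be null by Fubini, yet it
-- contains piece i up to the null graph of r.

universe u

/-! ### Free generators and independent functions -/

section Algebra

open MvPolynomial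

theorem aeval_sub_constantCoeff_mem_adjoin {K L σ : Type*} [Field K] [CommRing L] [Algebra K L]
    (x : σ → L) (P : MvPolynomial σ K) :
    aeval x P - algebraMap K L (constantCoeff P) ∈
      NonUnitalAlgebra.adjoin K (Set.range x) := by
  induction P using MvPolynomial.induction_on with
  | C a => simp
  | add p q hp hq =>
    have h := add_mem hp hq
    simp only [map_add]
    convert h using 1
    ring
  | mul_X p i hp =>
    have hx : x i ∈ NonUnitalAlgebra.adjoin K (Set.range x) :=
      NonUnitalAlgebra.subset_adjoin K (Set.mem_range_self i)
    have h := add_mem (mul_mem hp hx)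
      (SMulMemClass.smul_mem (constantCoeff p) hx)
    convert h using 1
    simp only [map_mul, aeval_X, constantCoeff_X, mul_zero, map_zero, Algebra.smul_def]
    ring

/-- A family in `L` all of whose non-zero polynomial combinations without constant term lie in `A`
witnesses strong algebrability of `A`. -/
theorem stronglyAlgebrable_of_aeval_mem {K : Type*} {L σ : Type u} [Field K] [CommRing L]
    [Algebra K L] {A : Set L} (hA : (0 : L) ∉ A) (x : σ → L)
    (hx : ∀ P : MvPolynomial σ K, P ≠ 0 → constantCoeff P = 0 → aeval x P ∈ A) :
    StronglyAlgebrable K #σ A := by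
  have hinj : Function.Injective x := by
    intro i j hij
    by_contra hne
    have hP : (X i - X j : MvPolynomial σ K) ≠ 0 :=
      sub_ne_zero.2 fun h => hne (X_injective h)
    have h := hx _ hP (by simp)
    rw [map_sub, aeval_X, aeval_X, hij, sub_self] at h
    exact hA h
  have hX : ∀ P : MvPolynomial (Set.range x) K, P ≠ 0 → constantCoeff P = 0 →
      aeval (Subtype.val : Set.range x → L) P ∈ A := by
    intro P hP hc
    let s : Set.range x ≃ σ := (Equiv.ofInjective x hinj).symm
    have h := hx (rename s P)
      (fun h => hP (rename_injective _ s.injective (by rw [h, map_zero])))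
      (by rw [constantCoeff_rename, hc])
    rw [aeval_rename] at h
    convert h using 3
    funext y
    exact (Equiv.apply_ofInjective_symm hinj y).symm
  have hmem : ∀ P : freeCommAlgebra K (Set.range x),
      aeval (Subtype.val : Set.range x → L) (P : MvPolynomial (Set.range x) K) ∈
        NonUnitalAlgebra.adjoin K (Set.range x) := by
    intro P
    have h := aeval_sub_constantCoeff_mem_adjoin (Subtype.val : Set.range x → L) P.1
    rwa [show constantCoeff P.1 = 0 from P.2, map_zero, sub_zero, Subtype.range_coe] at h
  let e₀ : freeCommAlgebra K (Set.range x) →ₙₐ[K] L :=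
    ((aeval (Subtype.val : Set.range x → L) :
        MvPolynomial (Set.range x) K →ₐ[K] L) : MvPolynomial (Set.range x) K →ₙₐ[K] L).comp
      (NonUnitalSubalgebraClass.subtype (freeCommAlgebra K (Set.range x)))
  let e := NonUnitalAlgHom.codRestrict e₀ (NonUnitalAlgebra.adjoin K (Set.range x)) hmem
  have he : ∀ P, (e P : L) = aeval (Subtype.val : Set.range x → L) P.1 := fun P => rfl
  have hsurj : ∀ y ∈ NonUnitalAlgebra.adjoin K (Set.range x), ∃ P, (e P : L) = y := by
    intro y hy
    induction hy using NonUnitalAlgebra.adjoin_induction with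
    | mem y hy => exact ⟨freeCommAlgebra.gen K ⟨y, hy⟩, aeval_X _ _⟩
    | add y z _ _ hy hz =>
      obtain ⟨P, rfl⟩ := hy
      obtain ⟨Q, rfl⟩ := hz
      exact ⟨P + Q, by rw [map_add]; rfl⟩
    | zero => exact ⟨0, by rw [map_zero]; rfl⟩
    | mul y z _ _ hy hz =>
      obtain ⟨P, rfl⟩ := hy
      obtain ⟨Q, rfl⟩ := hz
      exact ⟨P * Q, by rw [map_mul]; rfl⟩
    | smul r y _ hy =>
      obtain ⟨P, rfl⟩ := hy
      exact ⟨r • P, by rw [map_smul]; rfl⟩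
  refine ⟨_, ?_, Set.range x, Cardinal.mk_range_eq x hinj, rfl, e, ⟨?_, ?_⟩, ?_⟩
  · intro y hy
    obtain ⟨P, rfl⟩ := hsurj y hy
    by_cases hP : P.1 = 0
    · right
      rw [he, hP, map_zero]
      rfl
    · exact Or.inl (hX P.1 hP P.2)
  · rw [injective_iff_map_eq_zero]
    intro P hP
    by_contra hne
    have h := hX P.1 (fun h => hne (Subtype.ext h)) P.2
    rw [← he, hP] at h
    exact hA h
  · rintro ⟨y, hy⟩
    obtain ⟨P, hP⟩ := hsurj y hy
    exact ⟨P, Subtype.ext hP⟩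
  · intro y
    exact aeval_X _ _

/-- On a set of cardinality `𝔠` there are `2 ^ 𝔠` algebraically independent real functions. -/
theorem exists_independent_functions {ι : Type} (hι : #ι = 𝔠) :
    ∃ u : Set ℝ → ι → ℝ, ∀ P : MvPolynomial (Set ℝ) ℝ, P ≠ 0 →
      ∃ i, eval (fun A => u A i) P ≠ 0 := by
  classical
  have hcard : #ι = #(Finset ℝ × (Finset ℝ →₀ ℝ)) := by
    simp [hι, Cardinal.mk_finset_of_infinite, Cardinal.mk_real]
  obtain ⟨e⟩ := Cardinal.eq.1 hcard
  -- An index codes a finite set S and a finitely supported c; the value of u_A there is c(A ∩ S).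
  refine ⟨fun A i => (e i).2 ((e i).1.filter (· ∈ A)), fun P hP => ?_⟩
  obtain ⟨t, ht⟩ : ∃ t : Set ℝ → ℝ, eval t P ≠ 0 := by
    by_contra! h
    exact hP (MvPolynomial.funext fun t => by rw [h, map_zero])
  obtain ⟨J, q, rfl⟩ := exists_finset_rename P
  have hd : ∀ A B : Set ℝ, ∃ x, A ≠ B → ¬ (x ∈ A ↔ x ∈ B) := by
    intro A B
    by_contra! h
    obtain ⟨hne, -⟩ := h 0
    exact hne (Set.ext fun x => (h x).2)
  choose d hd using hd
  -- S separates the finitely many sets in `J`, so their traces on S are distinct and c can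
  -- prescribe the values `t`.
  let S : Finset ℝ := (J ×ˢ J).image fun p => d p.1 p.2
  have hS : ∀ A ∈ J, ∀ B ∈ J, S.filter (· ∈ A) = S.filter (· ∈ B) → A = B := by
    intro A hA B hB h
    by_contra hne
    have hmem : d A B ∈ S :=
      Finset.mem_image.2 ⟨(A, B), Finset.mem_product.2 ⟨hA, hB⟩, rfl⟩
    have := Finset.ext_iff.1 h (d A B)
    simp only [Finset.mem_filter, hmem, true_and] at this
    exact hd A B hne this
  let c : Finset ℝ →₀ ℝ := ∑ B ∈ J, Finsupp.single (S.filter (· ∈ B)) (t B)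
  have hc : ∀ A ∈ J, c (S.filter (· ∈ A)) = t A := by
    intro A hA
    simp only [c, Finsupp.finsetSum_apply]
    rw [Finset.sum_eq_single_of_mem A hA, Finsupp.single_eq_same]
    intro B hB hne
    exact Finsupp.single_eq_of_ne fun h => hne (hS A hA B hB h).symm
  refine ⟨e.symm (S, c), ?_⟩
  rw [eval_rename] at ht ⊢
  convert ht using 3
  funext A
  simp only [Function.comp_apply, Equiv.apply_symm_apply]
  exact hc A A.2

end Algebra

/-! ### A Borel function rarely meeting a.e. differentiable ones -/

section Digits

/-- Steinhaus argument: take compact K in E and open U ⊇ K of measure below 3/2 that of K. Small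
translates of K stay in U and each misses less than |K|/2 of it, so the two missed parts cannot
cover K. -/
theorem exists_mem_add_mem_sub_mem {E : Set ℝ} (hE : MeasurableSet E) (hpos : 0 < volume E) :
    ∃ δ > 0, ∀ h : ℝ, |h| < δ → ∃ x ∈ E, x + h ∈ E ∧ x - h ∈ E := by
  obtain ⟨K, hKE, hK, hK0⟩ := hE.exists_lt_isCompact hpos
  have hKt : volume K ≠ ⊤ := hK.measure_lt_top.ne
  obtain ⟨U, hKU, hU, hUK⟩ := K.exists_isOpen_lt_add hKt (ENNReal.half_pos hK0.ne').ne'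
  obtain ⟨δ, hδ, hδU⟩ := hK.exists_thickening_subset_open hU hKU
  have key : ∀ h : ℝ, |h| < δ → volume (U \ (fun x => x + h) ⁻¹' K) < volume K / 2 := by
    intro h hh
    have hsub : (fun x => x + h) ⁻¹' K ⊆ U := by
      intro x hx
      refine hδU (Metric.mem_thickening_iff.2 ⟨x + h, hx, ?_⟩)
      simpa [Real.dist_eq] using hh
    have hm : MeasurableSet ((fun x => x + h) ⁻¹' K) :=
      (measurable_add_const h) hK.measurableSet
    have hv : volume ((fun x => x + h) ⁻¹' K) = volume K := measure_preimage_add_right _ _ _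
    rw [measure_sdiff hsub hm.nullMeasurableSet (by rwa [hv]), hv]
    exact ENNReal.sub_lt_of_lt_add (hv ▸ measure_mono hsub) (by rwa [add_comm])
  refine ⟨δ, hδ, fun h hh => ?_⟩
  by_contra! hcon
  have hcov : K ⊆ (U \ (fun x => x + h) ⁻¹' K) ∪ (U \ (fun x => x + -h) ⁻¹' K) := by
    intro x hx
    by_cases h1 : x + h ∈ K
    · refine Or.inr ⟨hKU hx, fun h2 => hcon x (hKE hx) (hKE h1) ?_⟩
      rw [sub_eq_add_neg]
      exact hKE h2
    · exact Or.inl ⟨hKU hx, h1⟩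
  have hlt : volume K < volume K / 2 + volume K / 2 :=
    (measure_mono hcov).trans_lt ((measure_union_le _ _).trans_lt
      (ENNReal.add_lt_add (key h hh) (key (-h) (by rwa [abs_neg]))))
  rw [ENNReal.add_halves] at hlt
  exact hlt.false

/-- The binary digit of `x` at the place `2 ^ (-k)`. -/
noncomputable def binaryDigit (k : ℕ) (x : ℝ) : ℝ := ((⌊2 ^ k * x⌋ % 2 : ℤ) : ℝ)

theorem measurable_binaryDigit (k : ℕ) : Measurable (binaryDigit k) :=
  (measurable_from_top (f := fun m : ℤ => ((m % 2 : ℤ) : ℝ))).comp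
    (measurable_const.mul measurable_id).floor

theorem abs_binaryDigit_le (k : ℕ) (x : ℝ) : |binaryDigit k x| ≤ 1 := by
  unfold binaryDigit
  rcases Int.emod_two_eq_zero_or_one ⌊2 ^ k * x⌋ with h | h <;> simp [h]

theorem floor_two_pow_mul_add (k : ℕ) (x : ℝ) :
    ⌊2 ^ k * (x + (1 / 2) ^ k)⌋ = ⌊2 ^ k * x⌋ + 1 := by
  rw [mul_add, ← mul_pow]
  norm_num

/-- Turning digit k from 0 to 1 causes no carry: coarser digits depend only on half the floor, and
finer ones see a shift by an even integer. -/
theorem binaryDigit_add_of_ne {k j : ℕ} {x : ℝ} (hx : ⌊2 ^ k * x⌋ % 2 = 0) (hj : j ≠ k) :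
    binaryDigit j (x + (1 / 2) ^ k) = binaryDigit j x := by
  unfold binaryDigit
  congr 1
  rcases lt_or_gt_of_ne hj with h | h
  · obtain ⟨i, rfl⟩ := Nat.exists_eq_add_of_lt h
    have key : ∀ y : ℝ, ⌊2 ^ j * y⌋ = ⌊2 ^ (j + i + 1) * y⌋ / 2 / 2 ^ i := by
      intro y
      have h2 : (2 : ℝ) ^ j * y = 2 ^ (j + i + 1) * y / ((2 ^ (i + 1) : ℕ) : ℝ) := by
        push_cast
        field_simp
        ring
      rw [h2, Int.floor_div_natCast, Int.ediv_ediv_of_nonneg (by norm_num)]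
      push_cast
      rw [pow_succ' (2 : ℤ) i]
    rw [key, key, floor_two_pow_mul_add]
    congr 2
    omega
  · obtain ⟨i, rfl⟩ := Nat.exists_eq_add_of_lt h
    have h2 : (2 : ℝ) ^ (k + i + 1) * (x + (1 / 2) ^ k) =
        2 ^ (k + i + 1) * x + ((2 * 2 ^ i : ℤ) : ℝ) := by
      push_cast
      rw [mul_add, show (2 : ℝ) ^ (k + i + 1) = 2 ^ k * (2 * 2 ^ i) by ring,
        mul_right_comm _ _ ((1 / 2 : ℝ) ^ k), ← mul_pow]
      norm_num
    rw [h2, Int.floor_add_intCast]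
    omega

/-- A Borel function that is not Lipschitz on any set of positive measure. -/
noncomputable def roughFunction (x : ℝ) : ℝ := ∑' k : ℕ, (3 / 4 : ℝ) ^ k * binaryDigit k x

theorem measurable_roughFunction : Measurable roughFunction :=
  Measurable.tsum fun k => (measurable_binaryDigit k).const_mul _

theorem summable_roughFunction (x : ℝ) :
    Summable fun k : ℕ => (3 / 4 : ℝ) ^ k * binaryDigit k x := by
  refine Summable.of_norm_bounded
    (summable_geometric_of_lt_one (r := (3 / 4 : ℝ)) (by norm_num) (by norm_num)) fun k => ?_
  rw [norm_mul, Real.norm_eq_abs, Real.norm_eq_abs, abs_of_nonneg (by positivity)]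
  exact mul_le_of_le_one_right (by positivity) (abs_binaryDigit_le k x)

theorem roughFunction_add_sub {k : ℕ} {x : ℝ} (hx : ⌊2 ^ k * x⌋ % 2 = 0) :
    roughFunction (x + (1 / 2) ^ k) - roughFunction x = (3 / 4) ^ k := by
  unfold roughFunction
  rw [← (summable_roughFunction _).tsum_sub (summable_roughFunction _), tsum_eq_single k]
  · have h1 : binaryDigit k x = 0 := by simp [binaryDigit, hx]
    have h2 : binaryDigit k (x + (1 / 2) ^ k) = 1 := by
      have h3 : (⌊2 ^ k * x⌋ + 1) % 2 = 1 := by omega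
      simp only [binaryDigit, floor_two_pow_mul_add, h3, Int.cast_one]
    rw [h1, h2]
    ring
  · intro j hj
    rw [binaryDigit_add_of_ne hx hj, sub_self]

theorem roughFunction_add_sub_or (k : ℕ) (x : ℝ) :
    roughFunction (x + (1 / 2) ^ k) - roughFunction x = (3 / 4) ^ k ∨
      roughFunction x - roughFunction (x - (1 / 2) ^ k) = (3 / 4) ^ k := by
  rcases Int.emod_two_eq_zero_or_one ⌊2 ^ k * x⌋ with h | h
  · exact Or.inl (roughFunction_add_sub h)
  · right
    have h1 := floor_two_pow_mul_add k (x - (1 / 2) ^ k)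
    rw [sub_add_cancel] at h1
    have h2 := roughFunction_add_sub (k := k) (x := x - (1 / 2) ^ k) (by omega)
    rwa [sub_add_cancel] at h2

/-- On a set of positive measure some x has both x ± 2^(-k) in the set. Flipping digit k moves
`roughFunction` by (3/4)^k towards one of them, while the Lipschitz bound allows (M+1)2^(-k); large
k contradicts this. -/
theorem volume_roughFunction_eq_of_locally_lipschitz {g : ℝ → ℝ} (hg : Continuous g) (M : ℕ) :
    volume {x | roughFunction x = g x ∧
      ∀ y, |y - x| < 1 / (M + 1) → |g y - g x| ≤ (M + 1) * |y - x|} = 0 := by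
  set E := {x | roughFunction x = g x ∧
    ∀ y, |y - x| < 1 / (M + 1) → |g y - g x| ≤ (M + 1) * |y - x|}
  have hE : MeasurableSet E := by
    refine (measurableSet_eq_fun measurable_roughFunction hg.measurable).inter
      (IsClosed.measurableSet (s := {x : ℝ | ∀ y : ℝ, |y - x| < 1 / (M + 1) →
        |g y - g x| ≤ (M + 1) * |y - x|}) ?_)
    simp only [Set.ofPred_forall, imp_iff_not_or, not_lt, Set.ofPred_or]
    exact isClosed_iInter fun y => (isClosed_le (by fun_prop) (by fun_prop)).union
      (isClosed_le (by fun_prop) (by fun_prop))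
  by_contra hne
  obtain ⟨δ, hδ, hE3⟩ := exists_mem_add_mem_sub_mem hE (pos_iff_ne_zero.2 hne)
  have hM : (0 : ℝ) < M + 1 := by positivity
  have t1 := tendsto_pow_atTop_nhds_zero_of_lt_one (r := (1 / 2 : ℝ)) (by norm_num) (by norm_num)
  have t2 := tendsto_pow_atTop_atTop_of_one_lt (r := (3 / 2 : ℝ)) (by norm_num)
  obtain ⟨k, hk1, hk2, hk3⟩ := ((t1.eventually_lt_const hδ).and
    ((t1.eventually_lt_const (one_div_pos.2 hM)).and
      (t2.eventually_gt_atTop ((M : ℝ) + 1)))).exists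
  have hp : (0 : ℝ) < (1 / 2) ^ k := by positivity
  have hlt : ((M : ℝ) + 1) * (1 / 2) ^ k < (3 / 4) ^ k := by
    have : (3 / 4 : ℝ) ^ k = (3 / 2) ^ k * (1 / 2) ^ k := by rw [← mul_pow]; norm_num
    rw [this]
    exact mul_lt_mul_of_pos_right hk3 hp
  obtain ⟨x, hx, hxp, hxm⟩ := hE3 ((1 / 2) ^ k) (by rwa [abs_of_pos hp])
  rcases roughFunction_add_sub_or k x with h | h
  · have h1 := hx.2 (x + (1 / 2) ^ k) (by rwa [add_sub_cancel_left, abs_of_pos hp])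
    rw [← hx.1, ← hxp.1, h, add_sub_cancel_left, abs_of_pos hp, abs_of_pos (by positivity)] at h1
    exact hlt.not_ge h1
  · have h1 := hxm.2 x (by rwa [sub_sub_cancel, abs_of_pos hp])
    rw [← hx.1, ← hxm.1, h, sub_sub_cancel, abs_of_pos hp, abs_of_pos (by positivity)] at h1
    exact hlt.not_ge h1

/-- Differentiability at x gives a Lipschitz bound at x for some M, so countably many null sets
suffice. -/
theorem volume_roughFunction_eq {g : ℝ → ℝ} (hg : Continuous g)
    (hd : ∀ᵐ x : ℝ, DifferentiableAt ℝ g x) : volume {x | roughFunction x = g x} = 0 := by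
  refine measure_mono_null (t := {x | ¬ DifferentiableAt ℝ g x} ∪
    ⋃ M : ℕ, {x | roughFunction x = g x ∧
      ∀ y, |y - x| < 1 / (M + 1) → |g y - g x| ≤ (M + 1) * |y - x|}) ?_
    (measure_union_null hd
      (measure_iUnion_null (volume_roughFunction_eq_of_locally_lipschitz hg)))
  intro x hx
  by_cases hdx : DifferentiableAt ℝ g x
  · right
    obtain ⟨c, hc, hO⟩ := hdx.isBigO_sub.exists_pos
    obtain ⟨ε, hε, hball⟩ := Metric.eventually_nhds_iff.1 hO.bound
    obtain ⟨M₁, hM₁⟩ := exists_nat_one_div_lt hε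
    obtain ⟨M₂, hM₂⟩ := exists_nat_ge c
    refine Set.mem_iUnion.2 ⟨max M₁ M₂, hx, fun y hy => ?_⟩
    have h1 : (M₁ : ℝ) ≤ (max M₁ M₂ : ℕ) := by exact_mod_cast le_max_left _ _
    have h2 : (M₂ : ℝ) ≤ (max M₁ M₂ : ℕ) := by exact_mod_cast le_max_right _ _
    have hy' : dist y x < ε := by
      rw [Real.dist_eq]
      refine hy.trans (lt_of_le_of_lt ?_ hM₁)
      gcongr
    refine (hball hy').trans ?_
    rw [Real.norm_eq_abs]
    gcongr
    linarith
  · exact Or.inl hdx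

end Digits

/-! ### Bernstein-type colourings -/

section Bernstein

/-- At most `κ` sets of cardinality at least `κ` admit an injective choice function. -/
theorem exists_injective_choice {I α : Type u} {κ : Cardinal.{u}} (hI : #I ≤ κ) (K : I → Set α)
    (hK : ∀ i, κ ≤ #(K i)) : ∃ x : I → α, Function.Injective x ∧ ∀ i, x i ∈ K i := by
  obtain ⟨r, wo, hr⟩ := Cardinal.exists_ord_eq I
  -- In a well-order of minimal type, fewer than κ points are already used at each stage.
  have hseg : ∀ i, #{j // r j i} < κ := fun i => (Cardinal.card_typein_lt i hr).trans_le hI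
  have step : ∀ i (y : ∀ j, r j i → α), ∃ a ∈ K i, ∀ j (h : r j i), y j h ≠ a := by
    intro i y
    by_contra! hcon
    have hsub : K i ⊆ Set.range fun j : {j // r j i} => y j.1 j.2 := by
      intro a ha
      obtain ⟨j, h, hj⟩ := hcon a ha
      exact ⟨⟨j, h⟩, hj⟩
    exact ((hK i).trans ((Cardinal.mk_le_mk_of_subset hsub).trans Cardinal.mk_range_le)).not_gt
      (hseg i)
  choose s hs hne using step
  have wf : WellFounded r := wo.wf
  let x : I → α := wf.fix s
  have hx : ∀ i, x i = s i fun j _ => x j := wf.fix_eq s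
  have hlt : ∀ i j, r j i → x j ≠ x i := by
    intro i j h
    rw [hx i]
    exact hne i (fun j _ => x j) j h
  refine ⟨x, fun i j hij => ?_, fun i => ?_⟩
  · rcases trichotomous_of r i j with h | h | h
    · exact (hlt j i h hij).elim
    · exact h
    · exact (hlt i j h hij.symm).elim
  · rw [hx i]
    exact hs i _

theorem continuum_le_mk_of_volume_pos {K : Set ℝ} (hK : IsClosed K) (hpos : 0 < volume K) :
    𝔠 ≤ #K := by
  obtain ⟨f, hf, -, hinj⟩ := hK.exists_nat_bool_injection_of_not_countable
    fun h => hpos.ne' (h.measure_zero _)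
  have h := (Cardinal.mk_range_eq f hinj).symm.le.trans (Cardinal.mk_le_mk_of_subset hf)
  simpa using h

theorem mk_measurableSet_real_le : #{s : Set ℝ | MeasurableSet s} ≤ 𝔠 := by
  have hc : #(MeasurableSpace.countableGeneratingSet ℝ) ≤ 𝔠 :=
    Cardinal.le_aleph0_iff_set_countable.2 MeasurableSpace.countable_countableGeneratingSet
      |>.trans Cardinal.aleph0_le_continuum
  have h := MeasurableSpace.cardinal_measurableSet_le_continuum hc
  rwa [MeasurableSpace.generateFrom_countableGeneratingSet] at h

/-- The real line can be coloured by `𝔠` colours, each of which meets every compact set of positive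
measure. -/
theorem exists_colouring {C : Type} [Inhabited C] (hC : #C ≤ 𝔠) :
    ∃ s : ℝ → C, ∀ K : Set ℝ, IsCompact K → 0 < volume K → ∀ c, ∃ x ∈ K, s x = c := by
  classical
  let T := {K : Set ℝ // IsCompact K ∧ 0 < volume K}
  have hT : #T ≤ 𝔠 :=
    (Cardinal.mk_le_mk_of_subset (t := {s : Set ℝ | MeasurableSet s})
      fun K (hK : IsCompact K ∧ 0 < volume K) => hK.1.measurableSet).trans mk_measurableSet_real_le
  have hI : #(T × C) ≤ 𝔠 := by
    rw [Cardinal.mk_prod, Cardinal.lift_id, Cardinal.lift_id, ← Cardinal.continuum_mul_self]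
    exact mul_le_mul' hT hC
  -- One point is reserved for each pair (compact set, colour); injectivity makes the colouring
  -- consistent.
  obtain ⟨x, hx, hxK⟩ := exists_injective_choice hI (fun i => i.1.1)
    fun i => continuum_le_mk_of_volume_pos i.1.2.1.isClosed i.1.2.2
  refine ⟨fun y => if h : ∃ i, x i = y then h.choose.2 else default, fun K hK hpos c => ?_⟩
  refine ⟨x (⟨K, hK, hpos⟩, c), hxK (⟨K, hK, hpos⟩, c), ?_⟩
  have h : ∃ i, x i = x (⟨K, hK, hpos⟩, c) := ⟨_, rfl⟩
  beta_reduce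
  rw [dif_pos h, hx h.choose_spec]

theorem not_nullMeasurableSet_of_meets {W : Set ℝ}
    (h : ∀ K : Set ℝ, IsCompact K → 0 < volume K → (K ∩ W).Nonempty ∧ (K ∩ Wᶜ).Nonempty) :
    ¬ NullMeasurableSet W (volume : Measure ℝ) := by
  have key : ∀ V : Set ℝ, NullMeasurableSet V (volume : Measure ℝ) →
      (∀ K : Set ℝ, IsCompact K → 0 < volume K → (K ∩ Vᶜ).Nonempty) → volume V = 0 := by
    intro V hV hm
    obtain ⟨t, htV, ht, hte⟩ := hV.exists_measurable_subset_ae_eq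
    rw [← measure_congr hte]
    by_contra hne
    obtain ⟨K, hKt, hK, hK0⟩ := ht.exists_lt_isCompact (pos_iff_ne_zero.2 hne)
    obtain ⟨x, hxK, hxV⟩ := hm K hK hK0
    exact hxV (htV (hKt hxK))
  intro hW
  have h1 := key W hW fun K hK h0 => (h K hK h0).2
  have h2 := key Wᶜ hW.compl fun K hK h0 => by rw [compl_compl]; exact (h K hK h0).1
  have h3 := measure_union_null h1 h2
  rw [Set.union_compl_self] at h3
  simp at h3

end Bernstein

/-! ### Fubini for thin sets -/

section Graphs

/-- A null-measurable subset of the plane with countable vertical sections is null. -/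
theorem volume_eq_zero_of_countable_sections {E : Set (ℝ × ℝ)}
    (hE : NullMeasurableSet E (volume : Measure (ℝ × ℝ)))
    (hc : ∀ x, {y | (x, y) ∈ E}.Countable) : volume E = 0 := by
  obtain ⟨t, htE, ht, hte⟩ := hE.exists_measurable_subset_ae_eq
  rw [← measure_congr hte, Measure.volume_eq_prod, Measure.measure_prod_null ht]
  exact Filter.Eventually.of_forall fun x =>
    (Set.Countable.mono (fun y (hy : (x, y) ∈ t) => htE hy) (hc x)).measure_zero _

end Graphs

/-! ### Superpositions and the colour-dependent algebra -/

section Superposition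

open MvPolynomial

/-- A function vanishing off the graph of `roughFunction` and the graph of a function that agrees
with every continuous function almost nowhere is weakly sup-measurable. -/
theorem weaklySupMeasurable_of_eq_zero_off_graphs {f : ℝ → ℝ} {F : ℝ × ℝ → ℝ}
    (hf : ∀ g : ℝ → ℝ, Continuous g → volume {x : ℝ | f x = g x} = 0)
    (hF : ∀ x y, y ≠ roughFunction x → y ≠ f x → F (x, y) = 0) : WeaklySupMeasurable F := by
  intro g hg hd
  have hnull := measure_union_null (volume_roughFunction_eq hg hd) (hf g hg)
  refine (measurable_const (a := (0 : ℝ))).nullMeasurable.congr ?_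
  filter_upwards [compl_mem_ae_iff.2 hnull] with x hx
  exact (hF x (g x) (fun h => hx (Or.inl h.symm)) fun h => hx (Or.inr h.symm)).symm

/-- Evaluation at a point commutes with polynomials; the missing constant term gives the value 0 at
`none`. -/
theorem aeval_option_elim {ι σ α : Type*} (u : σ → ι → ℝ) (c : α → Option ι)
    {P : MvPolynomial σ ℝ} (hP : constantCoeff P = 0) (a : α) :
    aeval (fun (s : σ) (b : α) => (c b).elim 0 (u s)) P a =
      (c a).elim 0 fun i => eval (fun s => u s i) P := by
  have h : aeval (fun (s : σ) (b : α) => (c b).elim 0 (u s)) P a =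
      eval (fun s => (c a).elim 0 (u s)) P := by
    change Pi.evalAlgHom ℝ (fun _ : α => ℝ) a (aeval _ P) = _
    rw [comp_aeval_apply]
    rfl
  rw [h]
  cases c a with
  | none =>
    simp only [Option.elim_none]
    rw [eval_zero', hP]
  | some i => rfl

end Superposition

theorem mainTheorem3 (hA : ConditionA) :
    StronglyAlgebrable ℝ ((2 : Cardinal) ^ 𝔠)
      {F : ℝ × ℝ → ℝ |
        WeaklySupMeasurable F ∧ ¬ SupMeasurable F ∧ ¬ LebesgueMeasurable F} := by
  classical
  obtain ⟨f, ι, G, hι, hdisj, hG, hGpos, hf⟩ := hA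
  obtain ⟨u, hu⟩ := exists_independent_functions hι
  have hcard : #(Option ι) ≤ 𝔠 := by
    rw [Cardinal.mk_option, hι]
    exact (Cardinal.add_one_eq Cardinal.aleph0_le_continuum).le
  obtain ⟨s, hs⟩ := exists_colouring hcard
  have hGf : ∀ i, ∀ p ∈ G i, p.2 = f p.1 := fun i p hp =>
    (hG ▸ Set.mem_iUnion.2 ⟨i, hp⟩ : p ∈ {p : ℝ × ℝ | p.2 = f p.1})
  let t : ℝ × ℝ → Option ι := fun p => if h : ∃ i, p ∈ G i then some h.choose else none
  have ht : ∀ i, ∀ p ∈ G i, t p = some i := by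
    intro i p hp
    have h : ∃ i, p ∈ G i := ⟨i, hp⟩
    simp only [t, dif_pos h, Option.some_inj]
    by_contra hne
    exact Set.disjoint_left.1 (hdisj hne) h.choose_spec hp
  have ht' : ∀ p, p.2 ≠ f p.1 → t p = none := fun p hp =>
    dif_neg fun ⟨i, hi⟩ => hp (hGf i p hi)
  -- The two graphs may overlap; there the Bernstein colour wins, which costs each piece only a null
  -- set.
  let c : ℝ × ℝ → Option ι := fun p => if p.2 = roughFunction p.1 then s p.1 else t p
  have hgraph : volume {p : ℝ × ℝ | p.2 = roughFunction p.1} = 0 := by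
    refine volume_eq_zero_of_countable_sections
      (measurableSet_eq_fun measurable_snd
        (measurable_roughFunction.comp measurable_fst)).nullMeasurableSet fun x => ?_
    exact Set.countable_singleton (roughFunction x)
  rw [show (2 : Cardinal) ^ 𝔠 = #(Set ℝ) by rw [Cardinal.mk_set, Cardinal.mk_real]]
  refine stronglyAlgebrable_of_aeval_mem ?_
    (fun (A : Set ℝ) (p : ℝ × ℝ) => (c p).elim 0 (u A)) fun P hP hP0 => ?_
  · rintro ⟨-, h, -⟩
    exact h fun g _ => (measurable_const (a := (0 : ℝ))).nullMeasurable
  have hval := aeval_option_elim u c hP0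
  set F := MvPolynomial.aeval (fun (A : Set ℝ) (p : ℝ × ℝ) => (c p).elim 0 (u A)) P
  obtain ⟨i, hi⟩ := hu P hP
  have hoff : ∀ x y, y ≠ roughFunction x → y ≠ f x → F (x, y) = 0 := by
    intro x y h1 h2
    rw [hval]
    simp only [c, if_neg h1, ht' (x, y) h2, Option.elim_none]
  refine ⟨weaklySupMeasurable_of_eq_zero_off_graphs hf hoff, fun hsup => ?_, fun hmeas => ?_⟩
  · have h0 := hsup roughFunction measurable_roughFunction.nullMeasurable
      (measurableSet_singleton (0 : ℝ)).compl
    refine not_nullMeasurableSet_of_meets (fun K hK hpos => ⟨?_, ?_⟩) h0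
    · obtain ⟨x, hxK, hx⟩ := hs K hK hpos (some i)
      refine ⟨x, hxK, ?_⟩
      simp only [Set.mem_preimage, Set.mem_compl_iff, Set.mem_singleton_iff,
        caratheodorySuperposition, hval, c, if_true, hx, Option.elim_some]
      exact hi
    · obtain ⟨x, hxK, hx⟩ := hs K hK hpos none
      refine ⟨x, hxK, ?_⟩
      simp only [Set.mem_preimage, Set.mem_compl_iff, Set.mem_singleton_iff, not_not,
        caratheodorySuperposition, hval, c, if_true, hx, Option.elim_none]
  · have h0 : volume (F ⁻¹' {0}ᶜ) = 0 := by
      refine volume_eq_zero_of_countable_sections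
        (hmeas (measurableSet_singleton (0 : ℝ)).compl) fun x => ?_
      refine Set.Countable.mono (s₂ := {roughFunction x, f x}) (fun y hy => ?_)
        (Set.toFinite _).countable
      by_contra hne
      simp only [Set.mem_insert_iff, Set.mem_singleton_iff, not_or] at hne
      exact hy (hoff x y hne.1 hne.2)
    refine (hGpos i).ne' (measure_mono_null (fun p hp => ?_) (measure_union_null hgraph h0))
    by_cases h : p.2 = roughFunction p.1
    · exact Or.inl h
    · right
      simp only [Set.mem_preimage, Set.mem_compl_iff, Set.mem_singleton_iff, hval, c, if_neg h,
        ht i p hp, Option.elim_some]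
      exact hi
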